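/- Let $G=(V,E)$ be a finite simple graph such that every edge is avoided by some spanning tree of $G$, with nonzero real edge weights $\gamma_e$ and real numbers $\omega=(\omega_i)_{i\in V}$. Orient the edges, let $B$ be the resulting $V\times E$ incidence matrix ($B_{ie}=1$ if $i$ is the head of $e$, $-1$ if $i$ is its tail, $0$ otherwise), $B^{-1}$ its Moore–Penrose pseudoinverse, $D_\gamma=\operatorname{diag}(\gamma_e)$, and let $v_1,\dots,v_c$ be a $\mathbb Z$-basis of the cycle space $\ker B\cap\mathbb Z^E$. For a family $\mathcal I=(I_e)_{e\in E}$ of Borel sets $I_e\subseteq\mathbb R$ such that $\sin$ is injective on each $I_e$, let $\sin_{\mathcal I}^{-1}$ be the componentwise inverse of the sine functions $\sin|_{I_e}$, and put, for $\alpha\in\mathbb R^c$, $$L(\alpha)=D_\gamma^{-1}B^{-1}\omega+\sum_{i=1}^c\alpha_iD_\gamma^{-1}v_i,\qquad A=\{\alpha\in\mathbb R^c: L(\alpha)_e\in\sin(I_e)\text{ for all }e\in E\},$$ $$W(\alpha)=\frac1{2\pi}\bigl(\langle v_1,\sin_{\mathcal I}^{-1}L(\alpha)\rangle,\dots,\langle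 v_c,\sin_{\mathcal I}^{-1}L(\alpha)\rangle\bigr)\quad(\alpha\in A).$$ Let $|W(A)|$ denote the $c$-dimensional Lebesgue measure of $W(A)$. Then $|W(A)|$ is finite for every such $\mathcal I$, and its maximum over all such $\mathcal I$ is attained at each of the two choices $$I_e=\begin{cases}[-\pi/2,\pi/2]&\text{if }\gamma_e>0,\\ [\pi/2,3\pi/2]&\text{if }\gamma_e<0,\end{cases}\qquad\text{and}\qquad I_e=\begin{cases}[\pi/2,3\pi/2]&\text{if }\gamma_e>0,\\ [-\pi/2,\pi/2]&\text{if }\gamma_e<0.\end{cases}$$ In particular, if all $\gamma_e$ are positive, then the maximum is attained when $I_e=[-\pi/2,\pi/2]$ for all $e$, and also when $I_e=[\pi/2,3\pi/2]$ for all $e$. -/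

import Mathlib

open MeasureTheory

namespace Kuramoto

noncomputable section

/-- The Moore-Penrose pseudoinverse of a linear map `f` between finite-dimensional Euclidean
spaces: project orthogonally onto the range of `f`, then invert the bijection
`(ker f)ᗮ → range f` induced by `f`. -/
def pseudoinverse {E F : Type*} [NormedAddCommGroup E] [InnerProductSpace ℝ E]
    [FiniteDimensional ℝ E] [NormedAddCommGroup F] [InnerProductSpace ℝ F]
    [FiniteDimensional ℝ F] (f : E →ₗ[ℝ] F) : F →ₗ[ℝ] E :=
  (LinearMap.ker f)ᗮ.subtype ∘ₗ
    (f.kerComplementEquivRange (Submodule.isCompl_orthogonal (LinearMap.ker f)).symm).symm ∘ₗ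
    ((LinearMap.range f).orthogonalProjectionOnto : F →ₗ[ℝ] LinearMap.range f)

/-- An orientation of the edges of a simple graph: each edge has a head and a tail, which are
its two end points. -/
structure EdgeOrientation {V : Type*} (G : SimpleGraph V) where
  head : G.edgeSet → V
  tail : G.edgeSet → V
  mk_eq : ∀ e : G.edgeSet, s(tail e, head e) = (e : Sym2 V)

variable {V : Type*} [Fintype V] [DecidableEq V] {G : SimpleGraph V} [DecidableRel G.Adj]

/-- The incidence matrix `B` of an oriented graph, with entries in a ring `R`. -/
def incidence (R : Type*) [Ring R] (o : EdgeOrientation G) : Matrix V G.edgeSet R :=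
  fun i e => if i = o.head e then 1 else if i = o.tail e then -1 else 0

/-- The cycle space: the additive group of integral vectors in the kernel of `B`. -/
def cycleSpace (o : EdgeOrientation G) : Submodule ℤ (G.edgeSet → ℤ) :=
  LinearMap.ker (incidence ℤ o).mulVecLin

/-- `B⁻¹ ω`, where `B⁻¹` is the pseudoinverse of `B`. -/
def incidencePinv (o : EdgeOrientation G) (ω : V → ℝ) : EuclideanSpace ℝ G.edgeSet :=
  pseudoinverse (incidence ℝ o).toEuclideanLin (WithLp.toLp 2 ω)

/-- `L(α) = D_γ⁻¹ B⁻¹ ω + ∑ i, α i • D_γ⁻¹ v_i`, for edge weights `γ`, natural frequencies `ω`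
and a basis `v` of the cycle space. -/
def L (o : EdgeOrientation G) (γ : G.edgeSet → ℝ) (ω : V → ℝ) {c : ℕ}
    (v : Module.Basis (Fin c) ℤ (cycleSpace o)) (α : Fin c → ℝ) : G.edgeSet → ℝ :=
  fun e => (γ e)⁻¹ * incidencePinv o ω e
    + ∑ i, α i * ((γ e)⁻¹ * (((v i : G.edgeSet → ℤ) e : ℤ) : ℝ))

/-- The inverse of the sine function restricted to a set `s` on which sine is injective; it is
meaningful on `Real.sin '' s`. -/
def sinInv (s : Set ℝ) : ℝ → ℝ := Function.invFunOn Real.sin s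

/-- The set `A` of those `α` for which `sin_I⁻¹ (L α)` is well-defined. -/
def A (o : EdgeOrientation G) (γ : G.edgeSet → ℝ) (ω : V → ℝ) {c : ℕ}
    (v : Module.Basis (Fin c) ℤ (cycleSpace o)) (I : G.edgeSet → Set ℝ) : Set (Fin c → ℝ) :=
  {α | ∀ e, L o γ ω v α e ∈ Real.sin '' I e}

/-- `W(α) = (1 / 2π) (⟨v_1, sin_I⁻¹ (L α)⟩, …, ⟨v_c, sin_I⁻¹ (L α)⟩)`. -/
def W (o : EdgeOrientation G) (γ : G.edgeSet → ℝ) (ω : V → ℝ) {c : ℕ}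
    (v : Module.Basis (Fin c) ℤ (cycleSpace o)) (I : G.edgeSet → Set ℝ)
    (α : Fin c → ℝ) : Fin c → ℝ :=
  fun i => 1 / (2 * Real.pi) *
    ∑ e, (((v i : G.edgeSet → ℤ) e : ℤ) : ℝ) * sinInv (I e) (L o γ ω v α e)

/-- The `c`-dimensional volume `|W(A)|`. -/
def volWA (o : EdgeOrientation G) (γ : G.edgeSet → ℝ) (ω : V → ℝ) {c : ℕ}
    (v : Module.Basis (Fin c) ℤ (cycleSpace o)) (I : G.edgeSet → Set ℝ) : ENNReal :=
  volume (W o γ ω v I '' A o γ ω v I)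

/-- The admissible choices of sets `I e`: (measurable) sets on which sine is injective. -/
def Admissible (I : G.edgeSet → Set ℝ) : Prop :=
  ∀ e, MeasurableSet (I e) ∧ Set.InjOn Real.sin (I e)

/-- The interval `[-π/2, π/2]`. -/
def nearInterval : Set ℝ := Set.Icc (-(Real.pi / 2)) (Real.pi / 2)

/-- The interval `[π/2, 3π/2]`. -/
def farInterval : Set ℝ := Set.Icc (Real.pi / 2) (3 * Real.pi / 2)

/-- The volumes `|W(A)|` that occur as the choice of the sets `I e` varies. -/
def volumes (o : EdgeOrientation G) (γ : G.edgeSet → ℝ) (ω : V → ℝ) {c : ℕ}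
    (v : Module.Basis (Fin c) ℤ (cycleSpace o)) : Set ENNReal :=
  {x | ∃ I : G.edgeSet → Set ℝ, Admissible I ∧ x = volWA o γ ω v I}

/-- `[-π/2, π/2]` on the edges of positive weight, `[π/2, 3π/2]` on those of negative weight. -/
def choiceOne (γ : G.edgeSet → ℝ) : G.edgeSet → Set ℝ :=
  fun e => if 0 < γ e then nearInterval else farInterval

/-- `[π/2, 3π/2]` on the edges of positive weight, `[-π/2, π/2]` on those of negative weight. -/
def choiceTwo (γ : G.edgeSet → ℝ) : G.edgeSet → Set ℝ :=
  fun e => if 0 < γ e then farInterval else nearInterval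

end

end Kuramoto

/-! Let `M` have the basis cycles `v i` as columns. On a fixed choice of sine branches, `W` has
Jacobian (1/2π) Mᵀ D M with D diagonal and entries ±(γ_e √(1 - L_e²))⁻¹, the signs depending on the
branches. By Cauchy–Binet its determinant is a sum of squared minors weighted by products of these
entries, so its absolute value is largest when all entries have the same sign. The integral of this
largest value over {|L_e| < 1 for all e} is `maxVolume`.

Upper bound: the interior of `A` splits into countably many disjoint pieces, one for each choice of
branches, and the area inequality applies to each (`volume_winding_image_regular_le`). The rest,
where some |L_e| = 1, has null image (`volume_winding_image_singular`); this needs every edge to lie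
on a cycle, which the spanning trees provide.

Attainment: for the two stated choices the signs agree, and monotonicity of arcsin makes `W`
injective on the interior, so the area formula is an equality (`volume_winding_image_of_aligned`).
That image is bounded, whence finiteness. -/

namespace Kuramoto

noncomputable section

/-! ### Cauchy–Binet for weighted Gram determinants. -/

section WeightedGram

open Matrix

variable {E n : Type*} [Fintype E] [DecidableEq E] [Fintype n] [DecidableEq n]

/-- The determinant of `Mᵀ D M`, expanded multilinearly along its rows. -/
theorem det_transpose_mul_diagonal_mul (M : Matrix E n ℝ) (d : E → ℝ) :
    (Mᵀ * diagonal d * M).det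
      = ∑ f : n → E, (∏ i, d (f i)) * ((∏ i, M (f i) i) * (M.submatrix f id).det) := by
  have h : (Mᵀ * diagonal d * M) = fun i => ∑ e, (d e * M e i) • M e := by
    ext i j
    rw [Matrix.mul_apply, Finset.sum_apply]
    simp [Matrix.mul_diagonal, mul_comm]
  rw [h]
  refine ((detRowAlternating (R := ℝ) (n := n)).toMultilinearMap.map_sum
    (fun i e => (d e * M e i) • M e)).trans ?_
  refine Finset.sum_congr rfl fun f _ => ?_
  refine ((detRowAlternating (R := ℝ) (n := n)).toMultilinearMap.map_smul_univ
    (fun i => d (f i) * M (f i) i) (fun i => M (f i))).trans ?_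
  rw [Finset.prod_mul_distrib, smul_eq_mul, mul_assoc]
  rfl

/-- A form of the Cauchy-Binet formula for `det (Mᵀ D M)`, with a sum over all functions. -/
theorem factorial_mul_det_transpose_mul_diagonal_mul (M : Matrix E n ℝ) (d : E → ℝ) :
    (Fintype.card (Equiv.Perm n) : ℝ) * (Mᵀ * diagonal d * M).det
      = ∑ f : n → E, (∏ i, d (f i)) * (M.submatrix f id).det ^ 2 := by
  have key (σ : Equiv.Perm n) : (Mᵀ * diagonal d * M).det = ∑ f : n → E,
      (∏ i, d (f i)) * (((Equiv.Perm.sign σ : ℤ) : ℝ) * (∏ i, M (f (σ i)) i)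
        * (M.submatrix f id).det) := by
    -- Replacing `f` by `f ∘ σ` only costs sign σ in the minor; summing over σ then turns the
    -- product of entries into a second copy of the minor.
    rw [det_transpose_mul_diagonal_mul, ← (Equiv.arrowCongr σ.symm (Equiv.refl E)).sum_comp]
    refine Finset.sum_congr rfl fun f _ => ?_
    change (∏ i, d ((f ∘ σ) i)) * ((∏ i, M ((f ∘ σ) i) i) * (M.submatrix (f ∘ σ) id).det) = _
    have e2 : ∏ i, d ((f ∘ σ) i) = ∏ i, d (f i) := Equiv.prod_comp σ fun i => d (f i)
    have e3 : (M.submatrix (f ∘ σ) id).det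
        = ((Equiv.Perm.sign σ : ℤ) : ℝ) * (M.submatrix f id).det := by
      rw [← det_permute σ (M.submatrix f id)]; rfl
    rw [e2, e3]
    simp only [Function.comp_apply]
    ring
  have h2 : ∑ σ : Equiv.Perm n, (Mᵀ * diagonal d * M).det
      = ∑ f : n → E, (∏ i, d (f i)) * (M.submatrix f id).det ^ 2 := by
    rw [Finset.sum_congr rfl fun σ _ => key σ, Finset.sum_comm]
    refine Finset.sum_congr rfl fun f _ => ?_
    rw [← Finset.mul_sum, ← Finset.sum_mul, sq]
    congr 2
    rw [det_apply']
    rfl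
  rw [← h2, Finset.sum_const, nsmul_eq_mul, Finset.card_univ]

/-- The squared minors are nonnegative, so the triangle inequality only affects the weights. -/
theorem abs_det_transpose_mul_diagonal_mul_le (M : Matrix E n ℝ) (d : E → ℝ) :
    |(Mᵀ * diagonal d * M).det| ≤ (Mᵀ * diagonal (fun e => |d e|) * M).det := by
  have hpos : (0 : ℝ) < Fintype.card (Equiv.Perm n) := by
    exact_mod_cast Fintype.card_pos
  refine le_of_mul_le_mul_left ?_ hpos
  rw [factorial_mul_det_transpose_mul_diagonal_mul]
  nth_rewrite 1 [← abs_of_pos hpos]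
  rw [← abs_mul, factorial_mul_det_transpose_mul_diagonal_mul]
  refine (Finset.abs_sum_le_sum_abs _ _).trans (le_of_eq ?_)
  refine Finset.sum_congr rfl fun f _ => ?_
  rw [abs_mul, abs_pow, sq_abs, Finset.abs_prod]

end WeightedGram

/-! ### The Jacobian of the winding map and the aligned case. -/

section Winding

open Matrix

variable {E : Type*} [Fintype E] [DecidableEq E] {c : ℕ}
  (M : Matrix E (Fin c) ℝ) (p g : E → ℝ)

/-- The affine map `α ↦ p + D_g M α`. -/
def affineFlow (α : Fin c → ℝ) (e : E) : ℝ := p e + g e * (M *ᵥ α) e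

/-- The vector `(1 / 2π) Mᵀ φ(p + D_g M α)`, for a function `φ e` on each coordinate. -/
def winding (φ : E → ℝ → ℝ) (α : Fin c → ℝ) : Fin c → ℝ :=
  fun i => 1 / (2 * Real.pi) * ∑ e, M e i * φ e (affineFlow M p g α e)

/-- The Jacobian matrix of `winding`, for the derivatives `d e` of the functions `φ e`. -/
def windingJacobian (d : E → ℝ) : Matrix (Fin c) (Fin c) ℝ :=
  (1 / (2 * Real.pi)) • (Mᵀ * diagonal (fun e => d e * g e) * M)

omit [Fintype E] [DecidableEq E] in
theorem hasFDerivAt_affineFlow (α : Fin c → ℝ) (e : E) :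
    HasFDerivAt (fun α => affineFlow M p g α e)
      (g e • (ContinuousLinearMap.proj e : (E → ℝ) →L[ℝ] ℝ).comp
        (LinearMap.toContinuousLinearMap (toLin' M))) α := by
  have h := ((ContinuousLinearMap.proj e : (E → ℝ) →L[ℝ] ℝ).comp
        (LinearMap.toContinuousLinearMap (toLin' M))).hasFDerivAt (x := α)
  exact (h.const_smul (g e)).const_add (p e)

omit [Fintype E] [DecidableEq E] in
theorem continuous_affineFlow (e : E) : Continuous fun α => affineFlow M p g α e :=
  continuous_iff_continuousAt.2 fun α => (hasFDerivAt_affineFlow M p g α e).continuousAt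

theorem hasFDerivAt_winding (φ : E → ℝ → ℝ) (d : E → ℝ) (α : Fin c → ℝ)
    (h : ∀ e, HasDerivAt (φ e) (d e) (affineFlow M p g α e)) :
    HasFDerivAt (winding M p g φ)
      (LinearMap.toContinuousLinearMap (toLin' (windingJacobian M g d))) α := by
  rw [hasFDerivAt_pi']
  intro i
  have h1 (e : E) := ((h e).comp_hasFDerivAt α (hasFDerivAt_affineFlow M p g α e)).const_smul (M e i)
  have h2 := (HasFDerivAt.sum (u := Finset.univ) fun e _ => h1 e).const_smul (1 / (2 * Real.pi))
  convert h2 using 1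
  · ext α; simp [winding]
  · ext α
    have h3 : (windingJacobian M g d *ᵥ α) i
        = 1 / (2 * Real.pi) * ∑ e, M e i * (d e * (g e * (M *ᵥ α) e)) := by
      rw [windingJacobian, Matrix.smul_mulVec, ← Matrix.mulVec_mulVec, ← Matrix.mulVec_mulVec,
        Pi.smul_apply, smul_eq_mul]
      congr 1
      simp only [Matrix.mulVec_diagonal, Matrix.mulVec_transpose, Matrix.vecMul, dotProduct]
      refine Finset.sum_congr rfl fun e _ => ?_
      ring
    simpa using h3

/-- The largest Jacobian determinant of `winding` for functions `φ e` with derivative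
`± 1 / √(1 - y ^ 2)`. -/
def windingDensity (α : Fin c → ℝ) : ENNReal :=
  ENNReal.ofReal ((1 / (2 * Real.pi)) • (Mᵀ * diagonal
    (fun e => |1 / √(1 - affineFlow M p g α e ^ 2) * g e|) * M)).det

theorem ofReal_abs_det_le_windingDensity (α : Fin c → ℝ) (ε : E → ℝ) (hε : ∀ e, |ε e| = 1) :
    ENNReal.ofReal |(LinearMap.toContinuousLinearMap (toLin' (windingJacobian M g
      fun e => ε e * (1 / √(1 - affineFlow M p g α e ^ 2))))).det| ≤ windingDensity M p g α := by
  refine ENNReal.ofReal_le_ofReal ?_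
  rw [LinearMap.det_toContinuousLinearMap, LinearMap.det_toLin', windingJacobian, det_smul,
    det_smul, abs_mul, abs_of_nonneg (by positivity)]
  refine mul_le_mul_of_nonneg_left ?_ (by positivity)
  refine (abs_det_transpose_mul_diagonal_mul_le _ _).trans (le_of_eq ?_)
  simp [abs_mul, hε]

/-- Aligned signs pull a common factor `s` out of the diagonal, and |s ^ c| = 1. -/
theorem ofReal_abs_det_eq_windingDensity (α : Fin c → ℝ) (ε : E → ℝ) (s : ℝ) (hs : |s| = 1)
    (hε : ∀ e, ε e * g e = s * |g e|) :
    ENNReal.ofReal |(LinearMap.toContinuousLinearMap (toLin' (windingJacobian M g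
      fun e => ε e * (1 / √(1 - affineFlow M p g α e ^ 2))))).det| = windingDensity M p g α := by
  have h0 : (Mᵀ * diagonal (fun e => ε e * (1 / √(1 - affineFlow M p g α e ^ 2)) * g e) * M)
      = s • (Mᵀ * diagonal (fun e => |1 / √(1 - affineFlow M p g α e ^ 2) * g e|) * M) := by
    rw [← Matrix.smul_mul, ← Matrix.mul_smul, ← diagonal_smul]
    congr 3
    ext e
    simp only [Pi.smul_apply, smul_eq_mul, abs_mul]
    rw [abs_of_nonneg (by positivity : (0 : ℝ) ≤ 1 / √(1 - affineFlow M p g α e ^ 2))]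
    linear_combination (1 / √(1 - affineFlow M p g α e ^ 2)) * hε e
  -- For nonnegative weights the inequality says that the determinant is itself nonnegative.
  have h1 := abs_det_transpose_mul_diagonal_mul_le M
    (fun e => |1 / √(1 - affineFlow M p g α e ^ 2) * g e|)
  simp only [abs_abs] at h1
  have h2 := (abs_nonneg _).trans h1
  rw [windingDensity, LinearMap.det_toContinuousLinearMap, LinearMap.det_toLin', windingJacobian,
    h0, det_smul, det_smul, det_smul, abs_mul, abs_mul, abs_pow s, hs, one_pow, one_mul,
    abs_of_nonneg h2, abs_of_nonneg (by positivity)]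

/-- The set where `winding` is smooth for branches of the inverse of the sine. -/
def regularSet : Set (Fin c → ℝ) := {α | ∀ e, |affineFlow M p g α e| < 1}

omit [DecidableEq E] in
theorem measurableSet_regularSet : MeasurableSet (regularSet M p g) := by
  rw [regularSet, Set.ofPred_forall]
  exact MeasurableSet.iInter fun e => measurableSet_lt
    (continuous_affineFlow M p g e).abs.measurable measurable_const

theorem hasDerivAt_affine_arcsin (a ε : ℝ) {y : ℝ} (hy : |y| < 1) :
    HasDerivAt (fun y => a + ε * Real.arcsin y) (ε * (1 / √(1 - y ^ 2))) y := by
  rw [abs_lt] at hy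
  exact ((Real.hasDerivAt_arcsin hy.1.ne' hy.2.ne).const_mul ε).const_add a

omit [DecidableEq E] in
/-- If `φ e` is increasing where `g e` is positive, and decreasing where it is negative (or the
other way round throughout), then `winding` is injective. -/
theorem injOn_winding_of_aligned (hM : Function.Injective M.mulVec) (hg : ∀ e, g e ≠ 0)
    (a ε : E → ℝ) (s : ℝ) (hs : |s| = 1) (hε : ∀ e, ε e * g e = s * |g e|) :
    Set.InjOn (winding M p g fun e y => a e + ε e * Real.arcsin y) (regularSet M p g) := by
  intro α hα β hβ h
  set θ := fun (α : Fin c → ℝ) (e : E) => a e + ε e * Real.arcsin (affineFlow M p g α e) with hθ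
  have h1 (i) : ∑ e, M e i * (θ α e - θ β e) = 0 := by
    have := congrFun h i
    simp only [winding] at this
    have := mul_left_cancel₀ (by positivity) this
    simp only [mul_sub, Finset.sum_sub_distrib]
    simpa [sub_eq_zero] using this
  -- Pairing the vanishing difference of values with α - β gives a sum whose terms are all
  -- nonnegative, since arcsin is monotone; hence every term is zero.
  have h2 : ∑ e, s * ((M *ᵥ (α - β)) e * (θ α e - θ β e)) = 0 := by
    rw [← Finset.mul_sum]
    have : ∑ e, (M *ᵥ (α - β)) e * (θ α e - θ β e)
        = ∑ i, (α - β) i * ∑ e, M e i * (θ α e - θ β e) := by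
      simp only [Matrix.mulVec, dotProduct, Finset.sum_mul, Finset.mul_sum]
      rw [Finset.sum_comm]
      refine Finset.sum_congr rfl fun i _ => Finset.sum_congr rfl fun e _ => by ring
    simp [this, h1]
  have hss : s * s = 1 := by rw [← abs_mul_abs_self, hs, one_mul]
  have h3 (e) : (affineFlow M p g α e - affineFlow M p g β e) = g e * (M *ᵥ (α - β)) e := by
    simp [affineFlow, Matrix.mulVec_sub]; ring
  have h4 (e) : s * ((M *ᵥ (α - β)) e * (θ α e - θ β e)) = |g e|⁻¹ *
      ((affineFlow M p g α e - affineFlow M p g β e)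
        * (Real.arcsin (affineFlow M p g α e) - Real.arcsin (affineFlow M p g β e))) := by
    have hg' : |g e| ≠ 0 := abs_ne_zero.2 (hg e)
    rw [eq_inv_mul_iff_mul_eq₀ hg', h3]
    simp only [hθ]
    have : s * |g e| * ε e = g e := by
      have h5 : |g e| = s * (ε e * g e) := by rw [hε, ← mul_assoc, hss, one_mul]
      have h6 : |g e| * |g e| = g e * g e := abs_mul_abs_self _
      refine mul_right_cancel₀ (hg e) ?_
      rw [mul_assoc, hε, ← h6]
      linear_combination |g e| * |g e| * hss
    linear_combination (M *ᵥ (α - β)) e * (Real.arcsin (affineFlow M p g α e) -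
      Real.arcsin (affineFlow M p g β e)) * this
  have hnn (e) : 0 ≤ s * ((M *ᵥ (α - β)) e * (θ α e - θ β e)) := by
    rw [h4]
    refine mul_nonneg (by positivity) ?_
    rcases le_total (affineFlow M p g α e) (affineFlow M p g β e) with hl | hl
    · exact mul_nonneg_of_nonpos_of_nonpos (by linarith)
        (by linarith [Real.monotone_arcsin hl])
    · exact mul_nonneg (by linarith) (by linarith [Real.monotone_arcsin hl])
  have h5 (e) : affineFlow M p g α e = affineFlow M p g β e := by
    have h6 := (Finset.sum_eq_zero_iff_of_nonneg fun e _ => hnn e).1 h2 e (Finset.mem_univ _)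
    rw [h4, mul_eq_zero, mul_eq_zero] at h6
    rcases h6 with h6 | h6 | h6
    · exact absurd h6 (inv_ne_zero (abs_ne_zero.2 (hg e)))
    · linarith
    · have hα' := abs_lt.1 (hα e)
      have hβ' := abs_lt.1 (hβ e)
      exact Real.injOn_arcsin ⟨hα'.1.le, hα'.2.le⟩ ⟨hβ'.1.le, hβ'.2.le⟩ (by linarith)
  have h7 : M *ᵥ (α - β) = M *ᵥ 0 := by
    ext e
    have := h3 e
    rw [h5, sub_self, eq_comm, mul_eq_zero] at this
    simpa using this.resolve_left (hg e)
  exact sub_eq_zero.1 (hM h7)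

theorem volume_winding_image_of_aligned (hM : Function.Injective M.mulVec) (hg : ∀ e, g e ≠ 0)
    (a ε : E → ℝ) (s : ℝ) (hs : |s| = 1) (hε : ∀ e, ε e * g e = s * |g e|) :
    volume (winding M p g (fun e y => a e + ε e * Real.arcsin y) '' regularSet M p g)
      = ∫⁻ α in regularSet M p g, windingDensity M p g α := by
  rw [← lintegral_abs_det_fderiv_eq_addHaar_image volume (measurableSet_regularSet M p g)
    (fun α hα => (hasFDerivAt_winding M p g _ _ α fun e =>
      hasDerivAt_affine_arcsin (a e) (ε e) (hα e)).hasFDerivWithinAt)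
    (injOn_winding_of_aligned M p g hM hg a ε s hs hε)]
  exact lintegral_congr fun α => ofReal_abs_det_eq_windingDensity M p g α ε s hs hε

/-- The integral is the volume of an aligned image, which lies in a box because |arcsin| ≤ π/2. -/
theorem lintegral_windingDensity_lt_top (hM : Function.Injective M.mulVec) (hg : ∀ e, g e ≠ 0) :
    ∫⁻ α in regularSet M p g, windingDensity M p g α < ⊤ := by
  have h := volume_winding_image_of_aligned M p g hM hg 0 (fun e => SignType.sign (g e)) 1
    abs_one (fun e => by rw [one_mul, sign_mul_self])
  rw [← h]
  set R : Fin c → ℝ := fun i => 1 / (2 * Real.pi) * ∑ e, |M e i| * (Real.pi / 2)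
  refine (measure_mono (t := Set.Icc (-R) R) ?_).trans_lt measure_Icc_lt_top
  rintro _ ⟨α, -, rfl⟩
  have hb (i) : |winding M p g (fun e y => (0 : E → ℝ) e +
      (SignType.sign (g e) : ℝ) * Real.arcsin y) α i| ≤ R i := by
    simp only [winding, R, abs_mul]
    rw [abs_of_nonneg (by positivity)]
    refine mul_le_mul_of_nonneg_left ?_ (by positivity)
    refine (Finset.abs_sum_le_sum_abs _ _).trans (Finset.sum_le_sum fun e _ => ?_)
    rw [abs_mul]
    refine mul_le_mul_of_nonneg_left ?_ (abs_nonneg _)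
    simp only [Pi.zero_apply, zero_add, abs_mul]
    have h1 : |((SignType.sign (g e) : SignType) : ℝ)| ≤ 1 := by
      rcases SignType.sign (g e) <;> simp
    have h2 : |Real.arcsin (affineFlow M p g α e)| ≤ Real.pi / 2 :=
      abs_le.2 ⟨Real.neg_pi_div_two_le_arcsin _, Real.arcsin_le_pi_div_two _⟩
    calc _ ≤ 1 * (Real.pi / 2) := mul_le_mul h1 h2 (abs_nonneg _) zero_le_one
      _ = _ := one_mul _
  exact ⟨fun i => (abs_le.1 (hb i)).1, fun i => (abs_le.1 (hb i)).2⟩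

end Winding

/-! ### The upper bound for arbitrary admissible sets. -/

section UpperBound

open Matrix

variable {E : Type*} [Fintype E] [DecidableEq E] {c : ℕ}
  (M : Matrix E (Fin c) ℝ) (p g : E → ℝ)

/-- The branches of the inverse of the sine. -/
def arcsinBranch (k : ℤ) (y : ℝ) : ℝ := k * Real.pi + (-1) ^ k * Real.arcsin y

theorem measurable_arcsinBranch (k : ℤ) : Measurable (arcsinBranch k) :=
  (Real.continuous_arcsin.measurable.const_mul _).const_add _

theorem exists_arcsinBranch_eq (θ : ℝ) : ∃ k, arcsinBranch k (Real.sin θ) = θ := by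
  -- The integer nearest to θ/π, so that θ - kπ lies in [-π/2, π/2].
  refine ⟨⌊θ / Real.pi + 1 / 2⌋, ?_⟩
  set k := ⌊θ / Real.pi + 1 / 2⌋
  have h1 := Int.floor_le (θ / Real.pi + 1 / 2)
  have h2 := Int.lt_floor_add_one (θ / Real.pi + 1 / 2)
  have hθ : θ = θ / Real.pi * Real.pi := by field_simp
  have hp := Real.pi_pos
  have h3 : Real.arcsin (Real.sin (θ - k * Real.pi)) = θ - k * Real.pi :=
    Real.arcsin_sin (by nlinarith) (by nlinarith)
  rw [Real.sin_sub_int_mul_pi] at h3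
  rw [arcsinBranch]
  rcases Int.even_or_odd k with hk | hk
  · rw [hk.neg_one_zpow, one_mul] at h3 ⊢; linarith
  · rw [hk.neg_one_zpow, neg_one_mul, Real.arcsin_neg] at h3
    rw [hk.neg_one_zpow]; linarith

theorem sin_arcsinBranch (k : ℤ) {y : ℝ} (hy : |y| ≤ 1) : Real.sin (arcsinBranch k y) = y := by
  have h := Real.sin_arcsin (abs_le.1 hy).1 (abs_le.1 hy).2
  rw [arcsinBranch, add_comm, Real.sin_add_int_mul_pi]
  rcases Int.even_or_odd k with hk | hk <;> simp [hk.neg_one_zpow, h]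

/-- Branch k takes values within π/2 of kπ. Strictness matters: neighbouring branches meet at y =
±1. -/
theorem arcsinBranch_injective {y : ℝ} (hy : |y| < 1) {k l : ℤ}
    (h : arcsinBranch k y = arcsinBranch l y) : k = l := by
  have h1 := Real.neg_pi_div_two_lt_arcsin.2 (abs_lt.1 hy).1
  have h2 := Real.arcsin_lt_pi_div_two.2 (abs_lt.1 hy).2
  have hp := Real.pi_pos
  have key (k : ℤ) : |(-1 : ℝ) ^ k * Real.arcsin y| < Real.pi / 2 := by
    rw [abs_mul, abs_neg_one_zpow, one_mul, abs_lt]; exact ⟨by linarith, h2⟩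
  have hk := abs_lt.1 (key k)
  have hl := abs_lt.1 (key l)
  simp only [arcsinBranch] at h
  have a1 : ((k : ℝ) - l) < 1 := by nlinarith
  have a2 : ((l : ℝ) - k) < 1 := by nlinarith
  have b1 : k - l < 1 := by exact_mod_cast a1
  have b2 : l - k < 1 := by exact_mod_cast a2
  omega

/-- The domain of `winding` for the inverses of the restrictions of the sine to the sets `I e`. -/
def windingDomain (I : E → Set ℝ) : Set (Fin c → ℝ) :=
  {α | ∀ e, affineFlow M p g α e ∈ Real.sin '' I e}

/-- The part of the domain where `sinInv (I e)` is given by the branch `k e`. -/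
def branchPiece (I : E → Set ℝ) (k : E → ℤ) : Set (Fin c → ℝ) :=
  {α | ∀ e, |affineFlow M p g α e| < 1 ∧ arcsinBranch (k e) (affineFlow M p g α e) ∈ I e}

omit [DecidableEq E] in
theorem measurableSet_branchPiece {I : E → Set ℝ} (hI : ∀ e, MeasurableSet (I e)) (k : E → ℤ) :
    MeasurableSet (branchPiece M p g I k) := by
  rw [branchPiece, Set.ofPred_forall]
  refine MeasurableSet.iInter fun e => MeasurableSet.inter (measurableSet_lt
    (continuous_affineFlow M p g e).abs.measurable measurable_const) ?_
  exact ((measurable_arcsinBranch (k e)).comp (continuous_affineFlow M p g e).measurable) (hI e)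

omit [Fintype E] [DecidableEq E] in
theorem pairwise_disjoint_branchPiece {I : E → Set ℝ} (hI : ∀ e, Set.InjOn Real.sin (I e)) :
    Pairwise (Function.onFun Disjoint (branchPiece M p g I)) := by
  intro k l hkl
  refine Set.disjoint_left.2 fun α hk hl => hkl (funext fun e => ?_)
  refine arcsinBranch_injective (hk e).1 (hI e (hk e).2 (hl e).2 ?_)
  rw [sin_arcsinBranch _ (hk e).1.le, sin_arcsinBranch _ (hk e).1.le]

theorem sinInv_mem {s : Set ℝ} {y : ℝ} (hy : y ∈ Real.sin '' s) : sinInv s y ∈ s :=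
  Function.invFunOn_mem hy

theorem sin_sinInv {s : Set ℝ} {y : ℝ} (hy : y ∈ Real.sin '' s) : Real.sin (sinInv s y) = y :=
  Function.invFunOn_eq hy

theorem sinInv_eq {s : Set ℝ} (hs : Set.InjOn Real.sin s) {x y : ℝ} (hx : x ∈ s)
    (hxy : Real.sin x = y) : sinInv s y = x :=
  hs (sinInv_mem ⟨x, hx, hxy⟩) hx ((sin_sinInv ⟨x, hx, hxy⟩).trans hxy.symm)

omit [DecidableEq E] in
theorem winding_congr {φ ψ : E → ℝ → ℝ} {α : Fin c → ℝ}
    (h : ∀ e, φ e (affineFlow M p g α e) = ψ e (affineFlow M p g α e)) :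
    winding M p g φ α = winding M p g ψ α := by
  ext i; simp [winding, h]

/-- Images of different pieces may overlap, which only helps; the pieces themselves are disjoint, so
their integrals add up to at most the full one. -/
theorem volume_winding_image_regular_le {I : E → Set ℝ}
    (hI : ∀ e, MeasurableSet (I e) ∧ Set.InjOn Real.sin (I e)) :
    volume (winding M p g (fun e => sinInv (I e)) '' (windingDomain M p g I ∩ regularSet M p g))
      ≤ ∫⁻ α in regularSet M p g, windingDensity M p g α := by
  have hmeas := measurableSet_branchPiece M p g fun e => (hI e).1
  have hsub : winding M p g (fun e => sinInv (I e)) '' (windingDomain M p g I ∩ regularSet M p g) ⊆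
      ⋃ k, winding M p g (fun e => arcsinBranch (k e)) '' branchPiece M p g I k := by
    rintro _ ⟨α, ⟨hA, hU⟩, rfl⟩
    choose k hk using fun e => exists_arcsinBranch_eq (sinInv (I e) (affineFlow M p g α e))
    simp only [fun e => sin_sinInv (hA e)] at hk
    refine Set.mem_iUnion.2 ⟨k, α, fun e => ⟨hU e, ?_⟩, winding_congr M p g hk⟩
    rw [hk]
    exact sinInv_mem (hA e)
  calc _ ≤ ∑' k, volume (winding M p g (fun e => arcsinBranch (k e)) '' branchPiece M p g I k) :=
        (measure_mono hsub).trans (measure_iUnion_le _)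
    _ ≤ ∑' k, ∫⁻ α in branchPiece M p g I k, windingDensity M p g α := by
        refine ENNReal.tsum_le_tsum fun k => ?_
        refine (addHaar_image_le_lintegral_abs_det_fderiv volume (hmeas k)
          (fun α hα => (hasFDerivAt_winding M p g _ _ α fun e => hasDerivAt_affine_arcsin
            (k e * Real.pi) ((-1) ^ k e) (hα e).1).hasFDerivWithinAt)).trans ?_
        exact lintegral_mono fun α => ofReal_abs_det_le_windingDensity M p g α _
          fun e => abs_neg_one_zpow _
    _ = ∫⁻ α in ⋃ k, branchPiece M p g I k, windingDensity M p g α :=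
        (lintegral_iUnion hmeas (pairwise_disjoint_branchPiece M p g fun e => (hI e).2) _).symm
    _ ≤ _ := lintegral_mono_set (Set.iUnion_subset fun k α hα e => (hα e).1)

omit [Fintype E] [DecidableEq E] in
-- A nonzero row makes the level set a proper affine subspace: 0 and the `i`-th unit vector cannot
-- both lie in it.
theorem volume_affineFlow_eq (hg : ∀ e, g e ≠ 0) (hM : ∀ e, ∃ i, M e i ≠ 0) (e : E) (y : ℝ) :
    volume {α | affineFlow M p g α e = y} = 0 := by
  obtain ⟨i, hi⟩ := hM e
  let s : AffineSubspace ℝ (Fin c → ℝ) :=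
    (AffineSubspace.mk' y ⊥).comap
      ((g e • (LinearMap.proj e ∘ₗ M.mulVecLin)).toAffineMap + AffineMap.const ℝ _ (p e))
  have hs : (s : Set (Fin c → ℝ)) = {α | affineFlow M p g α e = y} := by
    ext α
    simp [s, affineFlow, sub_eq_zero, add_comm]
  rw [← hs]
  refine Measure.addHaar_affineSubspace volume s fun htop => ?_
  have h0 : (0 : Fin c → ℝ) ∈ (s : Set (Fin c → ℝ)) := by rw [htop]; trivial
  have h1 : (Pi.single i 1 : Fin c → ℝ) ∈ (s : Set (Fin c → ℝ)) := by rw [htop]; trivial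
  rw [hs] at h0 h1
  simp only [affineFlow, Set.mem_ofPred_eq, Matrix.mulVec_zero, Pi.zero_apply, mul_zero, add_zero,
    Matrix.mulVec_single_one] at h0 h1
  exact mul_ne_zero (hg e) hi (by simpa [Matrix.col] using h1.trans h0.symm)

/-- A null domain alone is not enough, as arcsin is not differentiable at ±1. But there the inverse
sine takes values (2k+1)π/2, so constants can replace it in the singular coordinates, giving
countably many differentiable maps on null sets. -/
theorem volume_winding_image_singular (hg : ∀ e, g e ≠ 0) (hM : ∀ e, ∃ i, M e i ≠ 0)
    (I : E → Set ℝ) :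
    volume (winding M p g (fun e => sinInv (I e)) '' (windingDomain M p g I \ regularSet M p g))
      = 0 := by
  -- The Boolean is true for a regular coordinate on branch `(κ e).1`, false for a constant one.
  let φ (κ : E → ℤ × Bool) (e : E) : ℝ → ℝ := if (κ e).2 then arcsinBranch (κ e).1 else
    fun _ => (2 * (κ e).1 + 1) * Real.pi / 2
  let P (κ : E → ℤ × Bool) : Set (Fin c → ℝ) :=
    {α | (∀ e, (κ e).2 → |affineFlow M p g α e| < 1) ∧ ∃ e, |affineFlow M p g α e| = 1}
  have hnull (κ) : volume (P κ) = 0 := by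
    refine measure_mono_null (t := ⋃ e, ({α | affineFlow M p g α e = 1} ∪
      {α | affineFlow M p g α e = -1})) ?_ ?_
    · rintro α ⟨-, e, he⟩
      exact Set.mem_iUnion.2 ⟨e, eq_or_eq_neg_of_abs_eq he⟩
    · exact measure_iUnion_null fun e => measure_union_null
        (volume_affineFlow_eq M p g hg hM e _) (volume_affineFlow_eq M p g hg hM e _)
  have hdiff (κ) : DifferentiableOn ℝ (winding M p g (φ κ)) (P κ) := by
    intro α hα
    have h (e) : ∃ d, HasDerivAt (φ κ e) d (affineFlow M p g α e) := by
      by_cases hκ : (κ e).2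
      · simp only [φ, hκ, if_true]
        exact ⟨_, hasDerivAt_affine_arcsin _ _ (hα.1 e hκ)⟩
      · simp only [φ, hκ]
        exact ⟨0, hasDerivAt_const _ _⟩
    choose d hd using h
    exact (hasFDerivAt_winding M p g _ d α hd).differentiableAt.differentiableWithinAt
  refine measure_mono_null (t := ⋃ κ, winding M p g (φ κ) '' P κ) ?_
    (measure_iUnion_null fun κ =>
      addHaar_image_eq_zero_of_differentiableOn_of_addHaar_eq_zero volume (hdiff κ) (hnull κ))
  rintro _ ⟨α, ⟨hA, hU⟩, rfl⟩
  have hle (e) : |affineFlow M p g α e| ≤ 1 := by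
    rw [← sin_sinInv (hA e)]; exact Real.abs_sin_le_one _
  have h (e) : ∃ κ : ℤ × Bool, (κ.2 → |affineFlow M p g α e| < 1) ∧
      (if κ.2 then arcsinBranch κ.1 else fun _ => (2 * κ.1 + 1) * Real.pi / 2)
        (affineFlow M p g α e) = sinInv (I e) (affineFlow M p g α e) := by
    rcases (hle e).lt_or_eq with hlt | heq
    · obtain ⟨k, hk⟩ := exists_arcsinBranch_eq (sinInv (I e) (affineFlow M p g α e))
      rw [sin_sinInv (hA e)] at hk
      exact ⟨(k, true), fun _ => hlt, by simpa using hk⟩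
    · have hcos : Real.cos (sinInv (I e) (affineFlow M p g α e)) = 0 := by
        rw [Real.cos_eq_zero_iff_sin_eq, sin_sinInv (hA e)]
        exact eq_or_eq_neg_of_abs_eq heq
      obtain ⟨k, hk⟩ := Real.cos_eq_zero_iff.1 hcos
      exact ⟨(k, false), by simp, by simpa using hk.symm⟩
  choose κ hκ using h
  refine Set.mem_iUnion.2 ⟨κ, α, ⟨fun e => (hκ e).1, ?_⟩, winding_congr M p g fun e => (hκ e).2⟩
  simp only [regularSet, Set.mem_ofPred_eq, not_forall, not_lt] at hU
  obtain ⟨e, he⟩ := hU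
  exact ⟨e, (hle e).antisymm he⟩

/-- The upper bound for the volume of the image of `winding`. -/
theorem volume_winding_image_le (hg : ∀ e, g e ≠ 0) (hM : ∀ e, ∃ i, M e i ≠ 0) {I : E → Set ℝ}
    (hI : ∀ e, MeasurableSet (I e) ∧ Set.InjOn Real.sin (I e)) :
    volume (winding M p g (fun e => sinInv (I e)) '' windingDomain M p g I)
      ≤ ∫⁻ α in regularSet M p g, windingDensity M p g α := by
  rw [← Set.inter_union_sdiff (windingDomain M p g I) (regularSet M p g), Set.image_union]
  refine (measure_union_le _ _).trans ?_
  rw [volume_winding_image_singular M p g hg hM, add_zero]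
  exact volume_winding_image_regular_le M p g hI

end UpperBound

end

end Kuramoto

namespace Kuramoto

/-! ### Sine on the two intervals. -/

section SineInverse

theorem injOn_sin_nearInterval : Set.InjOn Real.sin nearInterval := Real.injOn_sin

theorem injOn_sin_farInterval : Set.InjOn Real.sin farInterval := by
  intro x hx y hy h
  rw [← Real.sin_pi_sub x, ← Real.sin_pi_sub y] at h
  have hx' : Real.pi - x ∈ Set.Icc (-(Real.pi / 2)) (Real.pi / 2) :=
    ⟨by linarith [hx.2], by linarith [hx.1]⟩
  have hy' : Real.pi - y ∈ Set.Icc (-(Real.pi / 2)) (Real.pi / 2) :=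
    ⟨by linarith [hy.2], by linarith [hy.1]⟩
  linarith [Real.injOn_sin hx' hy' h]

theorem arcsin_mem_nearInterval (y : ℝ) : Real.arcsin y ∈ nearInterval :=
  Real.arcsin_mem_Icc y

theorem pi_sub_arcsin_mem_farInterval (y : ℝ) : Real.pi - Real.arcsin y ∈ farInterval :=
  ⟨by linarith [Real.arcsin_le_pi_div_two y], by linarith [Real.neg_pi_div_two_le_arcsin y]⟩

end SineInverse

variable {V : Type*} [Fintype V] [DecidableEq V] {G : SimpleGraph V} [DecidableRel G.Adj]

/-! ### Cycles through every edge, and independence of the cycle basis over ℝ. -/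

section Cycles

open Matrix

theorem incidence_mulVec_single (o : EdgeOrientation G) (e : G.edgeSet) :
    incidence ℤ o *ᵥ Pi.single e 1 = Pi.single (o.head e) 1 - Pi.single (o.tail e) 1 := by
  have hne : o.tail e ≠ o.head e := by
    have h := e.2
    rw [← o.mk_eq e] at h
    exact h.ne
  ext i
  simp only [Matrix.mulVec_single_one, Matrix.col_apply, incidence, Pi.sub_apply, Pi.single_apply]
  split_ifs with h1 h2
  · exact absurd (h2.symm.trans h1) hne
  all_goals simp

/-- A walk carries a unit flow between its end points. -/
theorem exists_incidence_mulVec_eq_of_walk (o : EdgeOrientation G) {T : SimpleGraph V}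
    (hT : T ≤ G) (e : G.edgeSet) (he : (e : Sym2 V) ∉ T.edgeSet) {a b : V} (w : T.Walk a b) :
    ∃ x : G.edgeSet → ℤ, x e = 0 ∧ incidence ℤ o *ᵥ x = Pi.single b 1 - Pi.single a 1 := by
  induction w with
  | nil => exact ⟨0, rfl, by simp⟩
  | @cons a b c h w ih =>
    obtain ⟨x, hx0, hx⟩ := ih
    let f : G.edgeSet := ⟨s(a, b), hT h⟩
    have hf : e ≠ f := fun hef => he (hef ▸ (h : s(a, b) ∈ T.edgeSet))
    have hs := incidence_mulVec_single o f
    rcases Sym2.eq_iff.1 (o.mk_eq f) with ⟨ht, hh⟩ | ⟨ht, hh⟩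
    · refine ⟨x + Pi.single f 1, by simp [hx0, hf], ?_⟩
      rw [Matrix.mulVec_add, hx, hs, ht, hh]; abel
    · refine ⟨x - Pi.single f 1, by simp [hx0, hf], ?_⟩
      rw [Matrix.mulVec_sub, hx, hs, ht, hh]; abel

/-- The fundamental cycle: a walk in `T` from head to tail of `e`, closed up by `e`, has coefficient
1 there. -/
theorem exists_mem_cycleSpace_apply_ne_zero (o : EdgeOrientation G) {T : SimpleGraph V}
    (hT : T ≤ G) (hconn : T.Connected) (e : G.edgeSet) (he : (e : Sym2 V) ∉ T.edgeSet) :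
    ∃ x ∈ cycleSpace o, x e ≠ 0 := by
  obtain ⟨w⟩ := hconn.preconnected (o.head e) (o.tail e)
  obtain ⟨x, hx0, hx⟩ := exists_incidence_mulVec_eq_of_walk o hT e he w
  refine ⟨x + Pi.single e 1, ?_, by simp [hx0]⟩
  rw [cycleSpace, LinearMap.mem_ker, Matrix.mulVecLin_apply, Matrix.mulVec_add, hx,
    incidence_mulVec_single]
  abel

/-- The real matrix whose columns are the vectors of a basis of the cycle space. -/
noncomputable def cycleMatrix {o : EdgeOrientation G} {c : ℕ} (v : Module.Basis (Fin c) ℤ (cycleSpace o)) :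
    Matrix G.edgeSet (Fin c) ℝ :=
  Matrix.of fun e i => (((v i : G.edgeSet → ℤ) e : ℤ) : ℝ)

theorem exists_cycleMatrix_ne_zero {o : EdgeOrientation G} {c : ℕ}
    (v : Module.Basis (Fin c) ℤ (cycleSpace o)) {e : G.edgeSet}
    (h : ∃ x ∈ cycleSpace o, x e ≠ 0) : ∃ i, cycleMatrix v e i ≠ 0 := by
  obtain ⟨x, hx, hxe⟩ := h
  by_contra! hz
  refine hxe ?_
  have h1 := congrArg (fun y : cycleSpace o => (y : G.edgeSet → ℤ) e) (v.sum_repr ⟨x, hx⟩)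
  simp only [AddSubmonoidClass.coe_finsetSum, Finset.sum_apply, Submodule.coe_smul,
    Pi.smul_apply] at h1
  rw [← h1]
  refine Finset.sum_eq_zero fun i _ => ?_
  have : (v i : G.edgeSet → ℤ) e = 0 := Int.cast_eq_zero (α := ℝ) |>.1 (hz i)
  rw [this, smul_zero]

/-- An integer matrix whose columns are independent over the integers has columns that are
independent over the reals. -/
theorem injective_mulVec_map_intCast {E n : Type*} [Fintype E] [Fintype n] [DecidableEq n]
    (N : Matrix E n ℤ) (hN : Function.Injective N.mulVec) :
    Function.Injective (N.map ((↑) : ℤ → ℝ)).mulVec := by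
  -- A kernel vector x of the Gram matrix has ⟨Nx, Nx⟩ = 0. Nonvanishing of this integer determinant
  -- survives the cast to ℝ.
  have hdet : (Nᵀ * N).det ≠ 0 := by
    intro h
    obtain ⟨x, hx, hx0⟩ := Matrix.exists_mulVec_eq_zero_iff.2 h
    refine hx (hN ?_)
    rw [Matrix.mulVec_zero, ← dotProduct_self_eq_zero, Matrix.dotProduct_mulVec,
      Matrix.vecMul_mulVec, ← Matrix.dotProduct_mulVec, hx0, dotProduct_zero]
  have hdet' : ((N.map ((↑) : ℤ → ℝ))ᵀ * N.map ((↑) : ℤ → ℝ)).det ≠ 0 := by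
    have h : (N.map ((↑) : ℤ → ℝ))ᵀ * N.map ((↑) : ℤ → ℝ) = (Nᵀ * N).map (Int.castRingHom ℝ) := by
      rw [Matrix.map_mul]; rfl
    rw [h, ← RingHom.mapMatrix_apply, ← RingHom.map_det]
    simpa using hdet
  intro x y hxy
  refine Matrix.mulVec_injective_of_isUnit
    ((Matrix.isUnit_iff_isUnit_det _).2 (isUnit_iff_ne_zero.2 hdet')) ?_
  simp only [← Matrix.mulVec_mulVec]
  exact congrArg _ hxy

theorem injective_cycleMatrix_mulVec {o : EdgeOrientation G} {c : ℕ}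
    (v : Module.Basis (Fin c) ℤ (cycleSpace o)) : Function.Injective (cycleMatrix v).mulVec := by
  refine injective_mulVec_map_intCast (Matrix.of fun e i => (v i : G.edgeSet → ℤ) e) ?_
  have h (x : Fin c → ℤ) : (Matrix.of fun e i => (v i : G.edgeSet → ℤ) e) *ᵥ x
      = (v.equivFun.symm x : G.edgeSet → ℤ) := by
    ext e
    simp [Matrix.mulVec, dotProduct, Module.Basis.equivFun_symm_apply, mul_comm]
  intro x y hxy
  simp only [h] at hxy
  exact v.equivFun.symm.injective (Subtype.ext hxy)

end Cycles

/-! ### Assembling the maximum. -/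

section Volumes

variable {o : EdgeOrientation G} {γ : G.edgeSet → ℝ} {ω : V → ℝ} {c : ℕ}
  {v : Module.Basis (Fin c) ℤ (cycleSpace o)}

theorem L_eq_affineFlow (α : Fin c → ℝ) : L o γ ω v α
    = affineFlow (cycleMatrix v) (fun e => (γ e)⁻¹ * incidencePinv o ω e) (fun e => (γ e)⁻¹) α := by
  ext e
  simp only [L, affineFlow, cycleMatrix, Matrix.mulVec, dotProduct, Finset.mul_sum, Matrix.of_apply]
  congr 1
  refine Finset.sum_congr rfl fun i _ => by ring

theorem volWA_eq (I : G.edgeSet → Set ℝ) : volWA o γ ω v I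
    = volume (winding (cycleMatrix v) (fun e => (γ e)⁻¹ * incidencePinv o ω e) (fun e => (γ e)⁻¹)
        (fun e => sinInv (I e)) '' windingDomain (cycleMatrix v)
          (fun e => (γ e)⁻¹ * incidencePinv o ω e) (fun e => (γ e)⁻¹) I) := by
  have hW : W o γ ω v I = winding (cycleMatrix v) (fun e => (γ e)⁻¹ * incidencePinv o ω e)
      (fun e => (γ e)⁻¹) (fun e => sinInv (I e)) := by
    ext α i
    simp only [W, winding, L_eq_affineFlow]
    rfl
  simp only [volWA, A, hW, windingDomain, L_eq_affineFlow]

/-- The maximal volume, as the integral of the maximal Jacobian determinant. -/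
noncomputable def maxVolume (o : EdgeOrientation G) (γ : G.edgeSet → ℝ) (ω : V → ℝ) {c : ℕ}
    (v : Module.Basis (Fin c) ℤ (cycleSpace o)) : ENNReal :=
  ∫⁻ α in regularSet (cycleMatrix v) (fun e => (γ e)⁻¹ * incidencePinv o ω e) (fun e => (γ e)⁻¹),
    windingDensity (cycleMatrix v) (fun e => (γ e)⁻¹ * incidencePinv o ω e) (fun e => (γ e)⁻¹) α

theorem maxVolume_lt_top (hγ : ∀ e, γ e ≠ 0) : maxVolume o γ ω v < ⊤ :=
  lintegral_windingDensity_lt_top _ _ _ (injective_cycleMatrix_mulVec v)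
    fun e => inv_ne_zero (hγ e)

theorem volWA_le_maxVolume (hγ : ∀ e, γ e ≠ 0) (hv : ∀ e, ∃ i, cycleMatrix v e i ≠ 0)
    {I : G.edgeSet → Set ℝ} (hI : Admissible I) : volWA o γ ω v I ≤ maxVolume o γ ω v := by
  rw [volWA_eq]
  exact volume_winding_image_le _ _ _ (fun e => inv_ne_zero (hγ e)) hv hI

/-- The aligned image of the interior alone already has the maximal volume, and it lies in `W(A)`.
-/
theorem maxVolume_le_volWA (hγ : ∀ e, γ e ≠ 0) {I : G.edgeSet → Set ℝ} (hI : Admissible I)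
    (a ε : G.edgeSet → ℝ) (s : ℝ) (hs : |s| = 1) (hε : ∀ e, ε e * (γ e)⁻¹ = s * |(γ e)⁻¹|)
    (hmem : ∀ e y, a e + ε e * Real.arcsin y ∈ I e)
    (hsin : ∀ e y, |y| < 1 → Real.sin (a e + ε e * Real.arcsin y) = y) :
    maxVolume o γ ω v ≤ volWA o γ ω v I := by
  rw [volWA_eq, maxVolume, ← volume_winding_image_of_aligned _ _ _
    (injective_cycleMatrix_mulVec v) (fun e => inv_ne_zero (hγ e)) a ε s hs hε]
  refine measure_mono ?_
  rintro _ ⟨α, hα, rfl⟩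
  refine ⟨α, fun e => ⟨_, hmem e _, hsin e _ (hα e)⟩, winding_congr _ _ _ fun e => ?_⟩
  exact sinInv_eq (hI e).2 (hmem e _) (hsin e _ (hα e))

omit [Fintype V] [DecidableEq V] [DecidableRel G.Adj] in
theorem admissible_ite (P : G.edgeSet → Prop) [DecidablePred P] :
    Admissible fun e => if P e then nearInterval else farInterval := by
  intro e
  dsimp only
  split_ifs
  · exact ⟨measurableSet_Icc, injOn_sin_nearInterval⟩
  · exact ⟨measurableSet_Icc, injOn_sin_farInterval⟩

theorem isGreatest_volumes_ite (hγ : ∀ e, γ e ≠ 0) (hv : ∀ e, ∃ i, cycleMatrix v e i ≠ 0)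
    (P : G.edgeSet → Prop) [DecidablePred P] (s : ℝ) (hs : |s| = 1)
    (hP : ∀ e, (if P e then 1 else -1) * (γ e)⁻¹ = s * |(γ e)⁻¹|) :
    IsGreatest (volumes o γ ω v)
      (volWA o γ ω v fun e => if P e then nearInterval else farInterval) := by
  refine ⟨⟨_, admissible_ite P, rfl⟩, ?_⟩
  rintro _ ⟨I, hI, rfl⟩
  refine (volWA_le_maxVolume hγ hv hI).trans (maxVolume_le_volWA hγ (admissible_ite P)
    -- The inverse sine is arcsin on the near interval and π - arcsin on the far one.
    (fun e => if P e then 0 else Real.pi) (fun e => if P e then 1 else -1) s hs hP ?_ ?_)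
  · intro e y
    split_ifs
    · simpa using arcsin_mem_nearInterval y
    · simpa [sub_eq_add_neg] using pi_sub_arcsin_mem_farInterval y
  · intro e y hy
    have h := Real.sin_arcsin (abs_lt.1 hy).1.le (abs_lt.1 hy).2.le
    split_ifs
    · simpa using h
    · simpa [← sub_eq_add_neg] using h

end Volumes

end Kuramoto

theorem theorem4 {V : Type*} [Fintype V] [DecidableEq V] (G : SimpleGraph V)
    [DecidableRel G.Adj]
    -- every edge is avoided by some spanning tree
    (hG : ∀ e ∈ G.edgeSet, ∃ T : SimpleGraph V, T ≤ G ∧ T.IsTree ∧ e ∉ T.edgeSet)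
    (o : Kuramoto.EdgeOrientation G)
    (γ : G.edgeSet → ℝ) (hγ : ∀ e, γ e ≠ 0) (ω : V → ℝ)
    {c : ℕ} (v : Module.Basis (Fin c) ℤ (Kuramoto.cycleSpace o)) :
    (∀ x ∈ Kuramoto.volumes o γ ω v, x < ⊤) ∧
    IsGreatest (Kuramoto.volumes o γ ω v) (Kuramoto.volWA o γ ω v (Kuramoto.choiceOne γ)) ∧
    IsGreatest (Kuramoto.volumes o γ ω v) (Kuramoto.volWA o γ ω v (Kuramoto.choiceTwo γ)) ∧
    Kuramoto.Admissible (Kuramoto.choiceOne γ) ∧ Kuramoto.Admissible (Kuramoto.choiceTwo γ) ∧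
    ((∀ e, 0 < γ e) →
      IsGreatest (Kuramoto.volumes o γ ω v)
        (Kuramoto.volWA o γ ω v (fun _ => Kuramoto.nearInterval)) ∧
      IsGreatest (Kuramoto.volumes o γ ω v)
        (Kuramoto.volWA o γ ω v (fun _ => Kuramoto.farInterval))) := by
  have hv (e : G.edgeSet) : ∃ i, Kuramoto.cycleMatrix v e i ≠ 0 := by
    obtain ⟨T, hT, htree, he⟩ := hG e e.2
    exact Kuramoto.exists_cycleMatrix_ne_zero v
      (Kuramoto.exists_mem_cycleSpace_apply_ne_zero o hT htree.connected e he)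
  have h_one : IsGreatest (Kuramoto.volumes o γ ω v)
      (Kuramoto.volWA o γ ω v (Kuramoto.choiceOne γ)) := by
    refine Kuramoto.isGreatest_volumes_ite hγ hv (fun e => 0 < γ e) 1 abs_one fun e => ?_
    split_ifs with h
    · rw [abs_of_pos (inv_pos.2 h)]
    · rw [abs_of_nonpos (inv_nonpos.2 (not_lt.1 h))]; ring
  have hflip : Kuramoto.choiceTwo γ
      = fun e => if ¬ 0 < γ e then Kuramoto.nearInterval else Kuramoto.farInterval := by
    ext1 e
    simp only [Kuramoto.choiceTwo, ite_not]
  have h_two : IsGreatest (Kuramoto.volumes o γ ω v)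
      (Kuramoto.volWA o γ ω v (Kuramoto.choiceTwo γ)) := by
    rw [hflip]
    -- All diagonal entries are now negative, hence the common sign -1.
    refine Kuramoto.isGreatest_volumes_ite hγ hv (fun e => ¬ 0 < γ e) (-1) (by simp) fun e => ?_
    split_ifs with h
    · rw [abs_of_pos (inv_pos.2 h)]
    · rw [abs_of_nonpos (inv_nonpos.2 (not_lt.1 h))]; ring
  refine ⟨?_, h_one, h_two, Kuramoto.admissible_ite _, ?_, fun hpos => ⟨?_, ?_⟩⟩
  · rintro _ ⟨I, hI, rfl⟩
    exact (Kuramoto.volWA_le_maxVolume hγ hv hI).trans_lt (Kuramoto.maxVolume_lt_top hγ)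
  · rw [hflip]
    exact Kuramoto.admissible_ite _
  · have h : Kuramoto.choiceOne γ = fun _ => Kuramoto.nearInterval :=
      funext fun e => if_pos (hpos e)
    rwa [← h]
  · have h : Kuramoto.choiceTwo γ = fun _ => Kuramoto.farInterval :=
      funext fun e => if_pos (hpos e)
    rwa [← h]
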